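/- Let $p$ be a prime, and let $|\cdot|_p$ be the $p$-adic absolute value, extended to $\overline{\mathbb{Q}}_p$ and its completion; $\mathbb{N}=\{1,2,\dots\}$. **Words.** For $N\ge 1$ let $\mathcal{A}_N=\{1,\dots,N\}$. For an infinite word $w=a_1a_2a_3\cdots$ of positive integers let $\mathrm{T}w=a_2a_3\cdots$ and let $w_n=a_1\cdots a_n$ be its prefix of length $n\ge 0$. For $a\in\mathbb{N}$ put $M_a=\begin{pmatrix}0&1\\1&a\end{pmatrix}$, and for a finite word $u=a_1\cdots a_n$ put $M_u=M_{a_1}\cdots M_{a_n}$ (the identity matrix if $u$ is empty). For $k,n\ge0$ let $$V(n,w)=\{M_{w_m}: m\ge 0,\ w_n \text{ is a prefix of } \mathrm{T}^m w\},$$ and let $V_k(n,w)$ be the image of $V(n,w)$ under reduction modulo $p^k$. Let $\phi_k$ also denote reduction modulo $p^k$ of matrices over $\mathbb{Z}_p$. **The sets $\mathbf{LMad}_\epsilon$.** For $\epsilon>0$ let $\mathbf{PBad}_\epsilon$ be the set of points $(q_1:q_2)\in\mathbf{P}^1_{\mathbb{Q}_p}$ such that for all $(a,b)\in\mathbb{Z}^2\setminus\{(0,0)\}$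 $$|aq_1+bq_2|_p\cdot\min\{|q_1|_p^{-1},|q_2|_p^{-1}\}\ \ge\ \epsilon\cdot\min\{|a|^{-2},|b|^{-2}\},$$ where the inverse of $0$ is read as $+\infty$. Extend $\mathrm{T}$ to pairs by $\mathrm{T}(w,\mathbf{q})=(\mathrm{T}w,M_{a_1}\mathbf{q})$, where $a_1$ is the first letter of $w$. Let $\mathbf{LMad}_\epsilon$ be the set of pairs $(w,\mathbf{x}_p)$ such that $\mathrm{T}^n(w,\mathbf{x}_p)\in\mathcal{A}_{\lfloor\epsilon^{-1}\rfloor+1}^{\mathbb{N}}\times\mathbf{PBad}_\epsilon$ for every $n\in\mathbb{N}$. **The class $\widetilde{\mathrm{SL}}_2(\mathbb{Z}_p)$.** It consists of the $2\times2$ matrices $A$ over $\mathbb{Z}_p$ with $\det A=\pm1$ that have two different eigenvectors in $\mathbf{P}^1_{\overline{\mathbb{Q}}_p}$ and are such that, for a positive integer $\kappa\le p^2$ with $|\lambda^{\kappa}-1|_p\le p^{-1}$ for each eigenvalue $\lambda$ of $A$, one has $\log(\lambda^{\kappa})\ne0$ for each eigenvalue $\lambda$ of $A$. Here $\log x=\sum_{n\ge1}(-1)^{n-1}(x-1)^n/n$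 for $|x-1|_p<1$. (Such a $\kappa$ always exists, and the condition does not depend on its choice.) **Theorem 6.1.** Let $A_1,A_2\in\widetilde{\mathrm{SL}}_2(\mathbb{Z}_p)$ be such that the eigenvectors $\mathbf{w}_1,\mathbf{w}_2$ of $A_1$ and $\mathbf{w}_3,\mathbf{w}_4$ of $A_2$ in $\mathbf{P}^1_{\overline{\mathbb{Q}}_p}$ are four distinct points. Then there is a constant $c>0$, depending only on $A_1$, $A_2$ and $p$, with the following property. Let $N\ge1$, let $w\in\mathcal{A}_N^{\mathbb{N}}$, and suppose that for some $k\ge0$ one has $\phi_k(A_1),\phi_k(A_2)\in V_k(n,w)$ for all $n\ge0$. Then for every $\mathbf{x}_p\in\mathbf{P}^1_{\mathbb{Q}_p}$ and every $\epsilon\ge c\,p^{-k}$ one has $(w,\mathbf{x}_p)\notin\mathbf{LMad}_\epsilon$. -/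

import Mathlib

open scoped LinearAlgebra.Projectivization

namespace PLC

/-! ### Words and their matrices -/

/-- The left shift on infinite words; the letters of `w` are `w 0, w 1, w 2, …`. -/
def shift (w : ℕ → ℕ) : ℕ → ℕ := fun i => w (i + 1)

/-- The prefix of length `n` of an infinite word. -/
def pre (w : ℕ → ℕ) (n : ℕ) : List ℕ := (List.range n).map w

/-- The infinite words over the alphabet `{1, …, N}`. -/
def words (N : ℕ) : Set (ℕ → ℕ) := {w | ∀ i, 1 ≤ w i ∧ w i ≤ N}

/-- The matrix of a single letter. -/
def letterMatrix (a : ℕ) : Matrix (Fin 2) (Fin 2) ℤ := !![0, 1; 1, (a : ℤ)]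

/-- The matrix of a finite word: the product, in order, of the matrices of its letters. -/
def wordMatrix (l : List ℕ) : Matrix (Fin 2) (Fin 2) ℤ := (l.map letterMatrix).prod

/-- `V(n, w)`: the matrices of those prefixes of `w` (of any length `m ≥ 0`) after which the word
starts again with its own prefix of length `n`. -/
def V (n : ℕ) (w : ℕ → ℕ) : Set (Matrix (Fin 2) (Fin 2) ℤ) :=
  {M | ∃ m : ℕ, pre (shift^[m] w) n = pre w n ∧ M = wordMatrix (pre w m)}

/-- `V_k(n, w)`: the reduction of `V(n, w)` modulo `p ^ k`. -/
def Vmod (p k n : ℕ) (w : ℕ → ℕ) : Set (Matrix (Fin 2) (Fin 2) (ZMod (p ^ k))) :=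
  (fun M => M.map (Int.castRingHom (ZMod (p ^ k)))) '' V n w

/-! ### The action on the projective line and the sets of badly approximable points -/

section Line

variable (p : ℕ) [Fact p.Prime]

/-- The projective line over the `p`-adic numbers. -/
abbrev Line : Type := ℙ ℚ_[p] (Fin 2 → ℚ_[p])

/-- The letter matrix over the `p`-adic numbers. -/
noncomputable def letterMatrixQ (a : ℕ) : Matrix (Fin 2) (Fin 2) ℚ_[p] :=
  (letterMatrix a).map (Int.castRingHom ℚ_[p])

theorem letterMatrixQ_injective (a : ℕ) :
    Function.Injective (Matrix.toLin' (letterMatrixQ p a)) := by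
  have hdet : (letterMatrixQ p a).det = -1 := by
    simp [letterMatrixQ, letterMatrix, Matrix.det_fin_two]
  have hu : IsUnit (letterMatrixQ p a) := by
    rw [Matrix.isUnit_iff_isUnit_det, hdet]
    exact isUnit_one.neg
  have h := Matrix.mulVec_injective_of_isUnit hu
  intro x y hxy
  exact h (by simpa [Matrix.toLin'_apply] using hxy)

/-- The action `q ↦ A_a q` on the projective line. -/
noncomputable def letterAct (a : ℕ) : Line p → Line p :=
  Projectivization.map (Matrix.toLin' (letterMatrixQ p a)) (letterMatrixQ_injective p a)

/-- The extended shift `T(w, q) = (Tw, A_{a₁} q)`, where `a₁` is the first letter of `w`. -/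
noncomputable def T (x : (ℕ → ℕ) × Line p) : (ℕ → ℕ) × Line p :=
  (shift x.1, letterAct p (x.1 0) x.2)

/-- The defining inequality of a `p`-adically badly approximable vector with constant `ε`:
`|a q₁ + b q₂|_p · min(|q₁|_p⁻¹, |q₂|_p⁻¹) ≥ min(|a|⁻², |b|⁻²) · ε` for all integers
`(a, b) ≠ (0, 0)`. With the convention that the inverse of `0` is `+∞`, the first minimum is
`max(|q₁|_p, |q₂|_p)⁻¹` and the second one is `max(|a|, |b|)⁻²`, as written here. -/
def BadVec (ε : ℝ) (v : Fin 2 → ℚ_[p]) : Prop :=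
  ∀ a b : ℤ, (a, b) ≠ (0, 0) →
    ((max |(a : ℝ)| |(b : ℝ)|) ^ 2)⁻¹ * ε ≤
      ‖(a : ℚ_[p]) * v 0 + (b : ℚ_[p]) * v 1‖ * (max ‖v 0‖ ‖v 1‖)⁻¹

/-- The points of the projective line that are `p`-adically badly approximable with constant `ε`. -/
def PBad (ε : ℝ) : Set (Line p) := {q | BadVec p ε q.rep}

theorem badVec_smul (ε : ℝ) (v : Fin 2 → ℚ_[p]) (c : ℚ_[p]) (hc : c ≠ 0) :
    BadVec p ε (c • v) ↔ BadVec p ε v := by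
  have hc' : ‖c‖ ≠ 0 := norm_ne_zero_iff.mpr hc
  unfold BadVec
  refine forall_congr' fun a => forall_congr' fun b => imp_congr_right fun _ => ?_
  have h1 : (a : ℚ_[p]) * (c • v) 0 + (b : ℚ_[p]) * (c • v) 1
      = c * ((a : ℚ_[p]) * v 0 + (b : ℚ_[p]) * v 1) := by
    simp only [Pi.smul_apply, smul_eq_mul]; ring
  have h2 : max ‖(c • v) 0‖ ‖(c • v) 1‖ = ‖c‖ * max ‖v 0‖ ‖v 1‖ := by
    simp only [Pi.smul_apply, smul_eq_mul, norm_mul]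
    exact (mul_max_of_nonneg _ _ (norm_nonneg c)).symm
  rw [h1, h2, norm_mul, mul_inv, mul_mul_mul_comm, mul_inv_cancel₀ hc', one_mul]

/-- Membership in `PBad` may be tested on any homogeneous coordinates of the point. -/
theorem mk_mem_PBad (ε : ℝ) (v : Fin 2 → ℚ_[p]) (hv : v ≠ 0) :
    Projectivization.mk ℚ_[p] v hv ∈ PBad p ε ↔ BadVec p ε v := by
  obtain ⟨c, hc⟩ := Projectivization.exists_smul_eq_mk_rep ℚ_[p] v hv
  change BadVec p ε (Projectivization.mk ℚ_[p] v hv).rep ↔ _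
  rw [← hc]
  exact badVec_smul p ε v c c.ne_zero

/-- `LMad_ε`: the pairs `(w, q)` such that `Tⁿ(w, q)` lies in `{1, …, N}^ℕ × PBad_ε` for every
positive integer `n`, where `N = ⌊ε⁻¹⌋ + 1`. -/
def LMad (ε : ℝ) : Set ((ℕ → ℕ) × Line p) :=
  {x | ∀ n : ℕ, 1 ≤ n →
    ((T p)^[n] x).1 ∈ words (⌊ε⁻¹⌋₊ + 1) ∧ ((T p)^[n] x).2 ∈ PBad p ε}

end Line

/-! ### The class of matrices -/

section Matrices

variable (p : ℕ) [Fact p.Prime]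

/-- A `p`-adic integer matrix over the algebraic closure of the `p`-adic numbers. -/
noncomputable def toAlgCl (A : Matrix (Fin 2) (Fin 2) ℤ_[p]) :
    Matrix (Fin 2) (Fin 2) (PadicAlgCl p) :=
  A.map (fun x => algebraMap ℚ_[p] (PadicAlgCl p) (x : ℚ_[p]))

/-- The eigenvectors of `A`, as points of the projective line over the algebraic closure. -/
def eigenpoints (A : Matrix (Fin 2) (Fin 2) ℤ_[p]) :
    Set (ℙ (PadicAlgCl p) (Fin 2 → PadicAlgCl p)) :=
  {v | ∃ μ : PadicAlgCl p, Module.End.HasEigenvector (Matrix.toLin' (toAlgCl p A)) μ v.rep}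

/-- The `p`-adic logarithm series `∑_{n ≥ 1} (-1)^(n-1) (x - 1)^n / n`, which converges for
`|x - 1|_p < 1`. -/
noncomputable def plog (x : ℂ_[p]) : ℂ_[p] :=
  ∑' n : ℕ, (-1 : ℂ_[p]) ^ n * (x - 1) ^ (n + 1) / ((n + 1 : ℕ) : ℂ_[p])

/-- The matrices over `ℤ_p` of determinant `±1` with two different eigenvectors in the projective
line over the algebraic closure, such that for a positive integer `κ ≤ p²` with
`|λ^κ - 1|_p ≤ p⁻¹` for each eigenvalue `λ`, the logarithms `log (λ^κ)` of both eigenvalues are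
non-zero. (Such an exponent always exists, and since `log (x ^ j) = j log x` the condition on the
logarithms does not depend on which one is taken.) -/
def SLtilde : Set (Matrix (Fin 2) (Fin 2) ℤ_[p]) :=
  {A | (A.det = 1 ∨ A.det = -1) ∧ (eigenpoints p A).Nontrivial ∧
    ∃ κ : ℕ, 0 < κ ∧ κ ≤ p ^ 2 ∧
      ∀ l : PadicAlgCl p, Module.End.HasEigenvalue (Matrix.toLin' (toAlgCl p A)) l →
        ‖l ^ κ - 1‖ ≤ (p : ℝ)⁻¹ ∧ plog p ((l ^ κ : PadicAlgCl p) : ℂ_[p]) ≠ 0}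

/-- Reduction of a matrix over `ℤ_p` modulo `p ^ k`. -/
noncomputable def red (k : ℕ) (A : Matrix (Fin 2) (Fin 2) ℤ_[p]) :
    Matrix (Fin 2) (Fin 2) (ZMod (p ^ k)) :=
  A.map (PadicInt.toZModPow k)

end Matrices

end PLC

/-! Represent the point by a vector `X` over `ℤ_p` with one coordinate 1. Letter matrices are
symmetric, so after `m` steps the orbit vector is the transpose of `M_{w_m}` applied to `X`, and an
integral form with coefficients `v` takes the value `X · M_{w_m} v` on it. If this is divisible by
`p^k` while the entries of `v` are at most `C`, then `ε ≤ C² p^{-k}` (`le_of_mem_LMad`). Return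
words can be concatenated, so every power `A^t` of either given matrix is some `M_{w_m}` modulo
`p^k` (`exists_return_pow`). It remains to find a nonzero `v`, bounded independently of `k`, and `t
≥ 1` with `p^k ∣ X · A^t v`.

Write `A^M = 1 + p² Y`. Then `X · A^{Mn} v = g_n (X · v) + p² h_n (X · Yv)`, and `n ↦ h_n / g_n`
hits every residue modulo `p^k` (`exists_powCoeff_solution`), so `n` exists once `p² (X · Yv)`
divides `X · v`. An integral `v` close to `perp X` achieves this if `X · Y (perp X)` is not too
small (`exists_nat_vector`).

That quantity vanishes only if `perp X` is an eigenvector of `A^M`. The logarithm condition keeps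
eigenvalues of `A` from being roots of unity, so `A^M` has no more eigenlines than `A`
(`mk_mem_eigenpoints_of_cross_pow`). As `A₁` and `A₂` share no eigenline, compactness gives a lower
bound, uniform in `X`, for one of the two quantities (`exists_uniform_dvd`). -/

namespace PLC

/-! ### Powers of a matrix congruent to the identity -/

section PowCoeff

variable {R : Type*} [CommRing R]

/-- The pair `(g, h)` with `(1 + P y) ^ n = g + P h y` whenever `y ^ 2 = τ y - δ`. -/
def powCoeff (P τ δ : R) : ℕ → R × R
  | 0 => (1, 0)
  | n + 1 => ((powCoeff P τ δ n).1 - P ^ 2 * δ * (powCoeff P τ δ n).2,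
      (powCoeff P τ δ n).1 + (powCoeff P τ δ n).2 * (1 + P * τ))

/-- By Cayley–Hamilton, powers of `1 + P Y` stay in the span of `1` and `Y`. -/
theorem one_add_smul_pow (P : R) (Y : Matrix (Fin 2) (Fin 2) R) (n : ℕ) :
    (1 + P • Y) ^ n = (powCoeff P Y.trace Y.det n).1 • (1 : Matrix (Fin 2) (Fin 2) R)
      + (P * (powCoeff P Y.trace Y.det n).2) • Y := by
  induction n with
  | zero => simp [powCoeff]
  | succ n ih =>
    rw [pow_succ, ih]
    ext i j
    fin_cases i <;> fin_cases j <;>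
      simp [powCoeff, Matrix.mul_apply, Fin.sum_univ_two, Matrix.trace_fin_two,
        Matrix.det_fin_two] <;> ring

theorem powCoeff_add (P τ δ : R) (m d : ℕ) :
    powCoeff P τ δ (m + d) =
      ((powCoeff P τ δ m).1 * (powCoeff P τ δ d).1
          - P ^ 2 * δ * ((powCoeff P τ δ m).2 * (powCoeff P τ δ d).2),
        (powCoeff P τ δ m).1 * (powCoeff P τ δ d).2 + (powCoeff P τ δ m).2 * (powCoeff P τ δ d).1
          + P * τ * ((powCoeff P τ δ m).2 * (powCoeff P τ δ d).2)) := by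
  induction d with
  | zero => simp [powCoeff]
  | succ d ih =>
    rw [← add_assoc, powCoeff, ih, powCoeff]
    ext <;> simp only <;> ring

theorem dvd_powCoeff_fst_sub_one (P τ δ : R) (n : ℕ) : P ∣ (powCoeff P τ δ n).1 - 1 := by
  induction n with
  | zero => simp [powCoeff]
  | succ n ih =>
    have h : (powCoeff P τ δ (n + 1)).1 - 1 = ((powCoeff P τ δ n).1 - 1)
        - P * (P * δ * (powCoeff P τ δ n).2) := by
      simp only [powCoeff]; ring
    rw [h]
    exact dvd_sub ih (dvd_mul_right _ _)

/-- Raising `g_d + P h_d y` to the `n`-th power gives the `y`-coefficient `n g_d^{n-1} P h_d` plus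
terms with further factors `P h_d`, and `g_d ≡ 1` modulo `P`. -/
theorem exists_powCoeff_mul (P τ δ : R) (d n : ℕ) :
    ∃ K : R, (powCoeff P τ δ (n * d)).2 = (powCoeff P τ δ d).2 * K ∧ P ∣ K - n := by
  induction n with
  | zero => exact ⟨0, by simp [powCoeff], by simp⟩
  | succ n ih =>
    obtain ⟨K, hK, u, hu⟩ := ih
    obtain ⟨v, hv⟩ := dvd_powCoeff_fst_sub_one P τ δ (n * d)
    obtain ⟨s, hs⟩ := dvd_powCoeff_fst_sub_one P τ δ d
    refine ⟨(powCoeff P τ δ (n * d)).1 + K * (powCoeff P τ δ d).1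
      + P * τ * (K * (powCoeff P τ δ d).2), ?_,
      v + u + K * s + τ * (K * (powCoeff P τ δ d).2), ?_⟩
    · rw [add_mul, one_mul, powCoeff_add]
      simp only [hK]
      ring
    · push_cast
      linear_combination hv + hu + K * hs

end PowCoeff

/-! ### Valuations of the power coefficients and solvability modulo powers of p -/

section PadicPow

variable {p : ℕ} [Fact p.Prime]

theorem isUnit_of_dvd_sub {a b : ℤ_[p]} (h : (p : ℤ_[p]) ∣ a - b) (hb : IsUnit b) : IsUnit a := by
  by_contra ha
  rw [PadicInt.not_isUnit_iff, PadicInt.norm_lt_one_iff_dvd] at ha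
  have : (p : ℤ_[p]) ∣ b := by simpa using dvd_sub ha h
  exact PadicInt.prime_p.not_isUnit (isUnit_of_dvd_unit this hb)

theorem isUnit_natCast_of_not_dvd {n : ℕ} (h : ¬ p ∣ n) : IsUnit (n : ℤ_[p]) := by
  rw [PadicInt.isUnit_iff, PadicInt.norm_natCast_eq_one_iff]
  exact (Nat.Prime.coprime_iff_not_dvd Fact.out).mpr h

/-- Factors of `p` are stripped from `n` one at a time. The modulus `p²` is what makes this work: `K
≡ p` modulo `p²` forces `K` to be `p` times a unit, also for `p = 2`. -/
theorem associated_powCoeff_snd (τ δ : ℤ_[p]) (n : ℕ) :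
    Associated (powCoeff ((p : ℤ_[p]) ^ 2) τ δ n).2 (n : ℤ_[p]) := by
  have hp : p.Prime := Fact.out
  induction n using Nat.strong_induction_on with
  | _ n ih =>
    rcases Nat.eq_zero_or_pos n with rfl | hn
    · simp [powCoeff]
    by_cases hpn : p ∣ n
    · obtain ⟨d, rfl⟩ := hpn
      have hd : 0 < d := Nat.pos_of_mul_pos_left hn
      have h1 := ih d (lt_mul_of_one_lt_left hd hp.one_lt)
      obtain ⟨K, hK, u, hu⟩ := exists_powCoeff_mul ((p : ℤ_[p]) ^ 2) τ δ d p
      have hU : IsUnit (1 + p * u) :=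
        isUnit_of_dvd_sub (b := 1) (by simp) isUnit_one
      have hK' : K = p * (1 + p * u) := by linear_combination hu
      rw [hK, Nat.cast_mul, mul_comm (p : ℤ_[p]), hK']
      refine h1.mul_mul ?_
      exact (associated_mul_unit_left _ _ hU)
    · obtain ⟨K, hK, u, hu⟩ := exists_powCoeff_mul ((p : ℤ_[p]) ^ 2) τ δ 1 n
      have hn' := isUnit_natCast_of_not_dvd hpn
      have hKu : IsUnit K := isUnit_of_dvd_sub (b := (n : ℤ_[p])) ⟨p * u, by rw [hu]; ring⟩ hn'
      have h1 : (powCoeff ((p : ℤ_[p]) ^ 2) τ δ 1).2 = 1 := by simp [powCoeff]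
      rw [mul_one, h1, one_mul] at hK
      rw [hK]
      exact (associated_one_iff_isUnit.mpr hKu).trans (associated_one_iff_isUnit.mpr hn').symm

theorem isUnit_powCoeff_fst (τ δ : ℤ_[p]) (n : ℕ) :
    IsUnit (powCoeff ((p : ℤ_[p]) ^ 2) τ δ n).1 :=
  isUnit_of_dvd_sub (b := 1)
    ((dvd_pow_self _ two_ne_zero).trans (dvd_powCoeff_fst_sub_one _ τ δ n)) isUnit_one

theorem toZModPow_eq_zero_iff (k : ℕ) (x : ℤ_[p]) :
    PadicInt.toZModPow k x = 0 ↔ (p : ℤ_[p]) ^ k ∣ x := by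
  rw [← RingHom.mem_ker, PadicInt.ker_toZModPow, Ideal.mem_span_singleton]

/-- The equation `g n * e + h n = 0` has a positive solution modulo every power of `p`, since
`n ↦ h n / g n` is a `p`-adic isometry. -/
theorem exists_powCoeff_solution (τ δ e : ℤ_[p]) (k : ℕ) :
    ∃ n : ℕ, 1 ≤ n ∧ (p : ℤ_[p]) ^ k ∣ (powCoeff ((p : ℤ_[p]) ^ 2) τ δ n).1 * e
      + (powCoeff ((p : ℤ_[p]) ^ 2) τ δ n).2 := by
  set g : ℕ → ℤ_[p] := fun n => (powCoeff ((p : ℤ_[p]) ^ 2) τ δ n).1 with hg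
  set h : ℕ → ℤ_[p] := fun n => (powCoeff ((p : ℤ_[p]) ^ 2) τ δ n).2 with hh
  choose gi hgi using fun n => (isUnit_powCoeff_fst τ δ n).exists_left_inv
  have key : ∀ m d : ℕ, (p : ℤ_[p]) ^ k ∣ gi (m + d) * h (m + d) - gi m * h m → p ^ k ∣ d := by
    intro m d hdvd
    have h1 : (p : ℤ_[p]) ^ k ∣ h (m + d) * g m - h m * g (m + d) := by
      have e1 : h (m + d) * g m - h m * g (m + d) =
          (gi (m + d) * h (m + d) - gi m * h m) * (g m * g (m + d)) := by
        linear_combination (-(h (m + d) * g m)) * hgi (m + d) + (h m * g (m + d)) * hgi m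
      rw [e1]
      exact hdvd.mul_right _
    -- The second factor is the norm of `g_m + p² h_m y`, a unit because `g_m` is one.
    have e2 : h (m + d) * g m - h m * g (m + d) = h d * (g m ^ 2
        + (p : ℤ_[p]) ^ 2 * (τ * h m * g m + (p : ℤ_[p]) ^ 2 * δ * h m ^ 2)) := by
      simp only [hg, hh, powCoeff_add]
      ring
    have hU : IsUnit (g m ^ 2
        + (p : ℤ_[p]) ^ 2 * (τ * h m * g m + (p : ℤ_[p]) ^ 2 * δ * h m ^ 2)) := by
      refine isUnit_of_dvd_sub (b := g m ^ 2) ?_ ((isUnit_powCoeff_fst τ δ m).pow 2)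
      rw [add_sub_cancel_left]
      exact (dvd_pow_self _ two_ne_zero).mul_right _
    rw [e2, hU.dvd_mul_right, (associated_powCoeff_snd τ δ d).dvd_iff_dvd_right] at h1
    have h2 := (PadicInt.pow_p_dvd_int_iff k (d : ℤ)).mp (by exact_mod_cast h1)
    exact_mod_cast h2
  -- Exponents run over `1, …, p^k`, so the solution is positive; injectivity between sets of equal
  -- size gives surjectivity.
  let F : Fin (p ^ k) → ZMod (p ^ k) :=
    fun n => PadicInt.toZModPow k (gi (n + 1) * h (n + 1))
  have hF : Function.Injective F := by
    have aux : ∀ a b : Fin (p ^ k), a ≤ b → F a = F b → a = b := by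
      intro a b hab hFab
      have h3 : (p : ℤ_[p]) ^ k ∣ gi (a + 1 + (b - a)) * h (a + 1 + (b - a))
          - gi (a + 1) * h (a + 1) := by
        rw [← toZModPow_eq_zero_iff, map_sub, sub_eq_zero]
        have : (a : ℕ) + 1 + (b - a) = b + 1 := by have : (a : ℕ) ≤ b := hab; omega
        rw [this]
        exact hFab.symm
      have h4 := Nat.eq_zero_of_dvd_of_lt (key _ _ h3) (by omega)
      have : (a : ℕ) ≤ b := hab
      ext
      omega
    intro a b hFab
    rcases le_total a b with hab | hab
    · exact aux a b hab hFab
    · exact (aux b a hab hFab.symm).symm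
  have hpk : NeZero (p ^ k) := ⟨pow_ne_zero _ (Nat.Prime.ne_zero Fact.out)⟩
  have hcard : Fintype.card (Fin (p ^ k)) = Fintype.card (ZMod (p ^ k)) := by
    rw [Fintype.card_fin, ZMod.card]
  obtain ⟨n, hn⟩ := ((Fintype.bijective_iff_injective_and_card F).mpr ⟨hF, hcard⟩).2
    (PadicInt.toZModPow k (-e))
  refine ⟨n + 1, by omega, ?_⟩
  have h5 : (p : ℤ_[p]) ^ k ∣ gi (n + 1) * h (n + 1) + e := by
    rw [← toZModPow_eq_zero_iff, map_add, ← sub_neg_eq_add, ← map_neg, sub_eq_zero]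
    exact hn
  have e3 : g (n + 1) * e + h (n + 1) = g (n + 1) * (gi (n + 1) * h (n + 1) + e) := by
    linear_combination (-h (n + 1)) * hgi (n + 1)
  change _ ∣ g (n + 1) * e + h (n + 1)
  rw [e3]
  exact h5.mul_left _

theorem exists_pow_dvd_dotProduct (Y : Matrix (Fin 2) (Fin 2) ℤ_[p]) (X v : Fin 2 → ℤ_[p])
    (h : (p : ℤ_[p]) ^ 2 * (X ⬝ᵥ Y.mulVec v) ∣ X ⬝ᵥ v) (k : ℕ) :
    ∃ n : ℕ, 1 ≤ n ∧ (p : ℤ_[p]) ^ k ∣ X ⬝ᵥ ((1 + (p : ℤ_[p]) ^ 2 • Y) ^ n).mulVec v := by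
  obtain ⟨e, he⟩ := h
  obtain ⟨n, hn, hdvd⟩ := exists_powCoeff_solution Y.trace Y.det e k
  refine ⟨n, hn, ?_⟩
  rw [one_add_smul_pow, Matrix.add_mulVec, Matrix.smul_mulVec, Matrix.smul_mulVec,
    Matrix.one_mulVec, dotProduct_add, dotProduct_smul, dotProduct_smul, he, smul_eq_mul,
    smul_eq_mul]
  convert hdvd.mul_left ((p : ℤ_[p]) ^ 2 * (X ⬝ᵥ Y.mulVec v)) using 1
  ring

end PadicPow

/-! ### The logarithm at roots of unity -/

section Log

open Filter Topology

variable {p : ℕ} [Fact p.Prime]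

theorem norm_inv_natCast_le (n : ℕ) : ‖((n : ℂ_[p]))⁻¹‖ ≤ n := by
  rcases Nat.eq_zero_or_pos n with rfl | hn
  · simp
  have h1 : ‖(n : ℂ_[p])‖ = ‖(n : ℚ_[p])‖ := by
    have h := PadicComplex.norm_extends' (p := p) (n : ℚ_[p])
    rw [← h]
    congr 1
    rw [map_natCast, PadicComplex.coe_natCast]
  rw [norm_inv, h1]
  have h2 : ((n : ℝ))⁻¹ ≤ ‖(n : ℚ_[p])‖ := by
    rw [Padic.norm_eq_zpow_neg_valuation (by exact_mod_cast hn.ne'), Padic.valuation_natCast,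
      zpow_neg, zpow_natCast]
    have hp : 0 < (p : ℝ) := by exact_mod_cast (Nat.Prime.pos Fact.out)
    refine inv_anti₀ (by positivity) ?_
    exact_mod_cast Nat.le_of_dvd hn pow_padicValNat_dvd
  exact inv_le_of_inv_le₀ (by exact_mod_cast hn) h2

theorem norm_natCast_le_one (n : ℕ) : ‖(n : ℂ_[p])‖ ≤ 1 :=
  IsUltrametricDist.norm_natCast_le_one ℂ_[p] n

theorem norm_prime_eq : ‖(p : ℂ_[p])‖ = (p : ℝ)⁻¹ := by
  have h := PadicComplex.norm_extends' (p := p) (p : ℚ_[p])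
  rw [map_natCast, PadicComplex.coe_natCast] at h
  rw [h, Padic.norm_p]

theorem norm_prime_lt_one : ‖(p : ℂ_[p])‖ < 1 := by
  rw [norm_prime_eq]
  exact inv_lt_one_of_one_lt₀ (by exact_mod_cast (Nat.Prime.one_lt Fact.out))

/-- The binomial coefficient is `p^j / (m + 1)` times an integer, with `m` fixed. -/
theorem tendsto_choose_prime_pow (m : ℕ) :
    Tendsto (fun j : ℕ => (((p ^ j).choose (m + 1) : ℕ) : ℂ_[p])) atTop (𝓝 0) := by
  have h1 : ∀ j : ℕ, (((p ^ j).choose (m + 1) : ℕ) : ℂ_[p]) =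
      (p : ℂ_[p]) ^ j * ((((p ^ j - 1).choose m : ℕ) : ℂ_[p]) * ((m + 1 : ℕ) : ℂ_[p])⁻¹) := by
    intro j
    have hpos : 0 < p ^ j := pow_pos (Nat.Prime.pos Fact.out) j
    have h2 := Nat.add_one_mul_choose_eq (p ^ j - 1) m
    rw [Nat.sub_add_cancel hpos] at h2
    have h3 : (p : ℂ_[p]) ^ j * (((p ^ j - 1).choose m : ℕ) : ℂ_[p]) =
      (((p ^ j).choose (m + 1) : ℕ) : ℂ_[p]) * ((m + 1 : ℕ) : ℂ_[p]) := by exact_mod_cast h2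
    have h4 : ((m + 1 : ℕ) : ℂ_[p]) ≠ 0 := by exact_mod_cast Nat.succ_ne_zero m
    rw [← mul_assoc, h3, mul_assoc, mul_inv_cancel₀ h4, mul_one]
  refine squeeze_zero_norm (a := fun j => ‖(p : ℂ_[p])‖ ^ j * (1 * ((m + 1 : ℕ) : ℝ))) ?_ ?_
  · intro j
    rw [h1, norm_mul, norm_mul, norm_pow]
    gcongr
    · exact norm_natCast_le_one _
    · exact norm_inv_natCast_le _
  · have := (tendsto_pow_atTop_nhds_zero_of_lt_one (norm_nonneg _)
      (norm_prime_lt_one (p := p))).mul_const (1 * ((m + 1 : ℕ) : ℝ))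
    simpa using this

theorem tendsto_choose_prime_pow_sub_one (m : ℕ) :
    Tendsto (fun j : ℕ => (((p ^ j - 1).choose m : ℕ) : ℂ_[p])) atTop (𝓝 ((-1) ^ m)) := by
  induction m with
  | zero => simp
  | succ m ih =>
    have h := (tendsto_choose_prime_pow (p := p) m).sub ih
    rw [zero_sub, ← neg_one_mul, ← pow_succ'] at h
    refine h.congr fun j => ?_
    have hpos : 0 < p ^ j := pow_pos (Nat.Prime.pos Fact.out) j
    have h2 := Nat.choose_succ_succ (p ^ j - 1) m
    rw [Nat.succ_eq_add_one, Nat.sub_add_cancel hpos] at h2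
    rw [h2]
    push_cast
    ring

theorem pow_prime_pow_sub_one_eq_tsum (z : ℂ_[p]) (j : ℕ) :
    ∑' n : ℕ, (((p ^ j - 1).choose n : ℕ) : ℂ_[p]) * z ^ (n + 1) / ((n + 1 : ℕ) : ℂ_[p]) =
      ((1 + z) ^ p ^ j - 1) / (p : ℂ_[p]) ^ j := by
  have hpos : 0 < p ^ j := pow_pos (Nat.Prime.pos Fact.out) j
  have hp0 : (p : ℂ_[p]) ^ j ≠ 0 :=
    pow_ne_zero _ (by exact_mod_cast (Nat.Prime.ne_zero (Fact.out : p.Prime)))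
  rw [tsum_eq_sum (s := Finset.range (p ^ j))]
  · rw [eq_div_iff hp0, add_comm 1 z, add_pow, Finset.sum_range_succ']
    simp only [one_pow, mul_one, pow_zero, Nat.choose_zero_right, Nat.cast_one,
      add_sub_cancel_right]
    rw [Finset.sum_mul]
    refine Finset.sum_congr rfl fun n _ => ?_
    have h2 := Nat.add_one_mul_choose_eq (p ^ j - 1) n
    rw [Nat.sub_add_cancel hpos] at h2
    have h3 : (p : ℂ_[p]) ^ j * (((p ^ j - 1).choose n : ℕ) : ℂ_[p]) =
      (((p ^ j).choose (n + 1) : ℕ) : ℂ_[p]) * ((n + 1 : ℕ) : ℂ_[p]) := by exact_mod_cast h2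
    have h4 : ((n + 1 : ℕ) : ℂ_[p]) ≠ 0 := by exact_mod_cast Nat.succ_ne_zero n
    rw [div_mul_eq_mul_div, div_eq_iff h4]
    linear_combination z ^ (n + 1) * h3
  · intro n hn
    rw [Finset.mem_range, not_lt] at hn
    rw [Nat.choose_eq_zero_of_lt (by omega)]
    simp

/-- The binomial expansion of the quotient has coefficients `C(p^j - 1, n) / (n + 1)`, which tend to
those of the logarithm series; dominated convergence applies because `|1/n|_p ≤ n`. -/
theorem tendsto_plog {x : ℂ_[p]} (hx : ‖x - 1‖ < 1) :
    Tendsto (fun j : ℕ => (x ^ p ^ j - 1) / (p : ℂ_[p]) ^ j) atTop (𝓝 (plog p x)) := by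
  have h := tendsto_tsum_of_dominated_convergence (𝓕 := atTop)
    (f := fun (j n : ℕ) =>
      (((p ^ j - 1).choose n : ℕ) : ℂ_[p]) * (x - 1) ^ (n + 1) / ((n + 1 : ℕ) : ℂ_[p]))
    (g := fun n : ℕ => (-1 : ℂ_[p]) ^ n * (x - 1) ^ (n + 1) / ((n + 1 : ℕ) : ℂ_[p]))
    (bound := fun n : ℕ => ((n + 1 : ℕ) : ℝ) * ‖x - 1‖ ^ (n + 1)) ?_ ?_ ?_
  · refine h.congr fun j => ?_
    rw [pow_prime_pow_sub_one_eq_tsum, add_sub_cancel]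
  · have h1 := summable_pow_mul_geometric_of_norm_lt_one 1 (r := ‖x - 1‖) (by simpa using hx)
    simpa using (summable_nat_add_iff 1).mpr h1
  · intro n
    exact ((tendsto_choose_prime_pow_sub_one n).mul_const _).div_const _
  · refine Eventually.of_forall fun j n => ?_
    rw [div_eq_mul_inv, norm_mul, norm_mul, norm_pow, mul_comm]
    refine mul_le_mul (norm_inv_natCast_le _) ?_ (by positivity) (by positivity)
    exact mul_le_of_le_one_left (by positivity) (norm_natCast_le_one _)

/-- For `n = p^a m` with `m` prime to `p`, the powers `x^{p^j}` are constant along `j = a + φ(m) i`.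
Convergence of the quotients forces that constant to be 1, so the limit is 0. -/
theorem plog_eq_zero_of_pow_eq_one {x : ℂ_[p]} (hx : ‖x - 1‖ < 1) {n : ℕ} (hn : 0 < n)
    (hxn : x ^ n = 1) : plog p x = 0 := by
  have hp : p.Prime := Fact.out
  obtain ⟨a, m, hm, rfl⟩ := Nat.exists_eq_pow_mul_and_not_dvd hn.ne' p hp.ne_one
  have hcop : Nat.Coprime p m := (Nat.Prime.coprime_iff_not_dvd hp).mpr hm
  have hm0 : 0 < m := Nat.pos_of_ne_zero (by rintro rfl; simp at hm)
  have hphi : 0 < m.totient := Nat.totient_pos.mpr hm0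
  have hconst : ∀ i : ℕ, x ^ p ^ (a + m.totient * i) = x ^ p ^ a := by
    intro i
    have h1 : p ^ (m.totient * i) ≡ 1 [MOD m] := by
      rw [pow_mul]
      simpa using (Nat.ModEq.pow_totient hcop).pow i
    rw [pow_add, pow_mul, pow_eq_pow_mod (p ^ (m.totient * i)) (by rw [← pow_mul]; exact hxn), h1,
      ← pow_eq_pow_mod 1 (by rw [← pow_mul]; exact hxn), pow_one]
  have htop : Tendsto (fun i : ℕ => a + m.totient * i) atTop atTop :=
    tendsto_atTop_mono
      (fun i => (Nat.le_mul_of_pos_left i hphi).trans (Nat.le_add_left _ _)) tendsto_id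
  have hlim := (tendsto_plog hx).comp htop
  have hp0 : (p : ℂ_[p]) ≠ 0 := by exact_mod_cast hp.ne_zero
  have hone : x ^ p ^ a = 1 := by
    have h2 := hlim.mul ((tendsto_pow_atTop_nhds_zero_of_norm_lt_one
      (norm_prime_lt_one (p := p))).comp htop)
    have h3 : Tendsto (fun _ : ℕ => x ^ p ^ a - 1) atTop (𝓝 (plog p x * 0)) := by
      refine h2.congr fun i => ?_
      simp only [Function.comp_apply]
      rw [div_mul_cancel₀ _ (pow_ne_zero _ hp0), hconst]
    rw [mul_zero] at h3
    exact sub_eq_zero.mp (tendsto_nhds_unique tendsto_const_nhds h3)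
  have h4 : Tendsto (fun _ : ℕ => (0 : ℂ_[p])) atTop (𝓝 (plog p x)) := by
    refine hlim.congr fun i => ?_
    simp only [Function.comp_apply]
    rw [hconst, hone, sub_self, zero_div]
  exact tendsto_nhds_unique h4 tendsto_const_nhds

end Log

/-! ### Eigenvectors of a power -/

section Eigen

theorem mk_eq_mk_of_cross {K : Type*} [Field K] {u v : Fin 2 → K} (hu : u ≠ 0) (hv : v ≠ 0)
    (h : u 0 * v 1 = u 1 * v 0) : Projectivization.mk K u hu = Projectivization.mk K v hv := by
  rw [Projectivization.mk_eq_mk_iff']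
  by_cases h0 : v 0 = 0
  · have h1 : v 1 ≠ 0 := fun h1 => hv (by ext i; fin_cases i <;> simp [h0, h1])
    refine ⟨u 1 / v 1, ?_⟩
    ext i
    fin_cases i
    · have : u 0 * v 1 = 0 := by rw [h, h0, mul_zero]
      simpa [h0] using ((mul_eq_zero.mp this).resolve_right h1).symm
    · simp [h1]
  · refine ⟨u 0 / v 0, ?_⟩
    ext i
    fin_cases i
    · simp [h0]
    · simp only [Fin.mk_one, Pi.smul_apply, smul_eq_mul]
      rw [div_mul_eq_mul_div, h, mul_div_cancel_right₀ _ h0]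

variable {p : ℕ} [Fact p.Prime]

/-- The inclusion of the `p`-adic integers in the algebraic closure of the `p`-adic numbers. -/
noncomputable def intToAlgCl (p : ℕ) [Fact p.Prime] : ℤ_[p] →+* PadicAlgCl p :=
  (algebraMap ℚ_[p] (PadicAlgCl p)).comp PadicInt.Coe.ringHom

theorem intToAlgCl_injective : Function.Injective (intToAlgCl p) :=
  (algebraMap ℚ_[p] (PadicAlgCl p)).injective.comp Subtype.coe_injective

theorem toAlgCl_eq_map (A : Matrix (Fin 2) (Fin 2) ℤ_[p]) : toAlgCl p A = A.map (intToAlgCl p) :=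
  rfl

theorem intToAlgCl_comp_ne_zero {y : Fin 2 → ℤ_[p]} (hy : y ≠ 0) : intToAlgCl p ∘ y ≠ 0 := by
  intro h
  refine hy (funext fun i => intToAlgCl_injective ?_)
  simpa using congrFun h i

theorem eigenvalue_pow_ne_one {A : Matrix (Fin 2) (Fin 2) ℤ_[p]} (hA : A ∈ SLtilde p)
    {l : PadicAlgCl p} (hl : Module.End.HasEigenvalue (Matrix.toLin' (toAlgCl p A)) l)
    {n : ℕ} (hn : 0 < n) : l ^ n ≠ 1 := by
  obtain ⟨-, -, κ, -, -, hκ⟩ := hA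
  obtain ⟨h1, h2⟩ := hκ l hl
  intro h
  refine h2 (plog_eq_zero_of_pow_eq_one (n := n) ?_ hn ?_)
  · have h3 : ((l ^ κ : PadicAlgCl p) : ℂ_[p]) - 1 = ((l ^ κ - 1 : PadicAlgCl p) : ℂ_[p]) := by
      simp only [PadicComplex.coe_eq, map_sub, map_one]
    rw [h3, PadicComplex.norm_extends]
    exact h1.trans_lt (inv_lt_one_of_one_lt₀ (by exact_mod_cast (Nat.Prime.one_lt Fact.out)))
  · rw [PadicComplex.coe_eq, ← map_pow, ← pow_mul, mul_comm, pow_mul, h, one_pow, map_one]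

theorem pow_mulVec_of_eigen {K : Type*} [CommRing K] {B : Matrix (Fin 2) (Fin 2) K}
    {e : Fin 2 → K} {μ : K} (h : B.mulVec e = μ • e) (M : ℕ) :
    (B ^ M).mulVec e = μ ^ M • e := by
  induction M with
  | zero => simp
  | succ M ih =>
    rw [pow_succ, ← Matrix.mulVec_mulVec, h, Matrix.mulVec_smul, ih, smul_smul, pow_succ']

/-- In an eigenbasis of `A`, the power `A^M` is diagonal with distinct entries, so a vector parallel
to its image lies on one of the two axes. -/
theorem mk_mem_eigenpoints_of_cross_pow {A : Matrix (Fin 2) (Fin 2) ℤ_[p]} (hA : A ∈ SLtilde p)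
    {M : ℕ} (hM : 0 < M) {y : Fin 2 → ℤ_[p]} (hy : y ≠ 0)
    (h : y 0 * ((A ^ M).mulVec y) 1 = y 1 * ((A ^ M).mulVec y) 0) :
    Projectivization.mk (PadicAlgCl p) (intToAlgCl p ∘ y) (intToAlgCl_comp_ne_zero hy) ∈
      eigenpoints p A := by
  obtain ⟨v₁, hv₁, v₂, hv₂, hne⟩ := hA.2.1
  obtain ⟨μ₁, h₁⟩ := id hv₁
  obtain ⟨μ₂, h₂⟩ := id hv₂
  set B := toAlgCl p A with hB
  set e := v₁.rep with he
  set f := v₂.rep with hf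
  have hD : e 0 * f 1 - e 1 * f 0 ≠ 0 := by
    intro h0
    refine hne ?_
    rw [← v₁.mk_rep, ← v₂.mk_rep]
    exact mk_eq_mk_of_cross _ _ (sub_eq_zero.mp h0)
  have hBe : B.mulVec e = μ₁ • e := by simpa using h₁.apply_eq_smul
  have hBf : B.mulVec f = μ₂ • f := by simpa using h₂.apply_eq_smul
  have hdet : μ₁ * μ₂ = B.det := by
    have a0 := congrFun hBe 0
    have a1 := congrFun hBe 1
    have b0 := congrFun hBf 0
    have b1 := congrFun hBf 1
    simp only [Matrix.mulVec, dotProduct, Fin.sum_univ_two, Pi.smul_apply, smul_eq_mul]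
      at a0 a1 b0 b1
    refine mul_right_cancel₀ hD ?_
    rw [Matrix.det_fin_two]
    linear_combination (-(μ₂ * f 1)) * a0 + (μ₂ * f 0) * a1 - (B 0 0 * e 0 + B 0 1 * e 1) * b1
      + (B 1 0 * e 0 + B 1 1 * e 1) * b0
  have hdet' : (B.det) ^ 2 = 1 := by
    have h3 : B.det = intToAlgCl p A.det := by
      rw [hB, toAlgCl_eq_map, RingHom.map_det]; rfl
    rcases hA.1 with h4 | h4 <;> rw [h3, h4] <;> simp
  -- Since `(μ₁ μ₂)² = 1`, equality would make `μ₁` a root of unity.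
  have hpow : μ₁ ^ M ≠ μ₂ ^ M := by
    intro h5
    have h6 : μ₁ ^ (4 * M) = 1 := by
      calc μ₁ ^ (4 * M) = (μ₁ ^ M * μ₁ ^ M) ^ 2 := by ring
        _ = (μ₁ ^ M * μ₂ ^ M) ^ 2 := by rw [← h5]
        _ = ((μ₁ * μ₂) ^ 2) ^ M := by ring
        _ = 1 := by rw [hdet, hdet', one_pow]
    exact eigenvalue_pow_ne_one hA (Module.End.hasEigenvalue_of_hasEigenvector h₁) (by omega) h6
  set y' := intToAlgCl p ∘ y with hy'
  have hy'M : (B ^ M).mulVec y' = intToAlgCl p ∘ ((A ^ M).mulVec y) := by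
    ext i
    rw [hB, toAlgCl_eq_map, Function.comp_apply, RingHom.map_mulVec, hy', Matrix.map_pow]
  have hcross : y' 0 * ((B ^ M).mulVec y') 1 = y' 1 * ((B ^ M).mulVec y') 0 := by
    rw [hy'M]
    simp only [hy', Function.comp_apply, ← map_mul, h]
  have hE := pow_mulVec_of_eigen hBe M
  have hF := pow_mulVec_of_eigen hBf M
  -- By Cramer's rule the factors are `D` times the coordinates of `y'` in the basis `e, f`.
  have hprod : (y' 0 * f 1 - y' 1 * f 0) * (e 0 * y' 1 - e 1 * y' 0) = 0 := by
    have a0 := congrFun hE 0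
    have a1 := congrFun hE 1
    have b0 := congrFun hF 0
    have b1 := congrFun hF 1
    simp only [Matrix.mulVec, dotProduct, Fin.sum_univ_two, Pi.smul_apply, smul_eq_mul]
      at a0 a1 b0 b1 hcross
    set a := y' 0 * f 1 - y' 1 * f 0 with ha
    set b := e 0 * y' 1 - e 1 * y' 0 with hb
    set D := e 0 * f 1 - e 1 * f 0 with hDdef
    have c0 : D * y' 0 = a * e 0 + b * f 0 := by rw [hDdef, ha, hb]; ring
    have c1 : D * y' 1 = a * e 1 + b * f 1 := by rw [hDdef, ha, hb]; ring
    have d0 : D * ((B ^ M) 0 0 * y' 0 + (B ^ M) 0 1 * y' 1)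
        = a * (μ₁ ^ M * e 0) + b * (μ₂ ^ M * f 0) := by
      linear_combination (B ^ M) 0 0 * c0 + (B ^ M) 0 1 * c1 + a * a0 + b * b0
    have d1 : D * ((B ^ M) 1 0 * y' 0 + (B ^ M) 1 1 * y' 1)
        = a * (μ₁ ^ M * e 1) + b * (μ₂ ^ M * f 1) := by
      linear_combination (B ^ M) 1 0 * c0 + (B ^ M) 1 1 * c1 + a * a1 + b * b1
    have h7 : (a * e 0 + b * f 0) * (a * (μ₁ ^ M * e 1) + b * (μ₂ ^ M * f 1))
        = (a * e 1 + b * f 1) * (a * (μ₁ ^ M * e 0) + b * (μ₂ ^ M * f 0)) := by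
      rw [← c0, ← c1, ← d0, ← d1]
      linear_combination D ^ 2 * hcross
    have h8 : (a * b) * ((μ₂ ^ M - μ₁ ^ M) * D) = 0 := by
      rw [hDdef]
      linear_combination h7
    exact (mul_eq_zero.mp h8).resolve_right (mul_ne_zero (sub_ne_zero.mpr hpow.symm) hD)
  rcases mul_eq_zero.mp hprod with h9 | h9
  · have h10 := mk_eq_mk_of_cross (intToAlgCl_comp_ne_zero hy) v₂.rep_nonzero (sub_eq_zero.mp h9)
    rw [h10, v₂.mk_rep]
    exact hv₂
  · have h10 := mk_eq_mk_of_cross (intToAlgCl_comp_ne_zero hy) v₁.rep_nonzero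
      (show y' 0 * e 1 = y' 1 * e 0 by linear_combination -h9)
    rw [h10, v₁.mk_rep]
    exact hv₁

/-- Every matrix of determinant `±1` has a positive power congruent to the identity mod `p²`. -/
theorem exists_pow_eq_one_add_smul {A : Matrix (Fin 2) (Fin 2) ℤ_[p]}
    (hA : A.det = 1 ∨ A.det = -1) :
    ∃ M : ℕ, 0 < M ∧ ∃ Y : Matrix (Fin 2) (Fin 2) ℤ_[p], A ^ M = 1 + (p : ℤ_[p]) ^ 2 • Y := by
  have hpk : NeZero (p ^ 2) := ⟨pow_ne_zero _ (Nat.Prime.ne_zero Fact.out)⟩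
  have hunit : IsUnit A := by
    rw [Matrix.isUnit_iff_isUnit_det]
    rcases hA with h | h <;> rw [h]
    exacts [isUnit_one, isUnit_one.neg]
  obtain ⟨u, hu⟩ := hunit.map (PadicInt.toZModPow (p := p) 2).mapMatrix
  obtain ⟨M, hM, hMu⟩ := (isOfFinOrder_of_finite u).exists_pow_eq_one
  have h1 : (PadicInt.toZModPow (p := p) 2).mapMatrix (A ^ M) = 1 := by
    rw [map_pow, ← hu, ← Units.val_pow_eq_pow_val, hMu, Units.val_one]
  have h2 : ∀ i j, ∃ y : ℤ_[p], (A ^ M - 1) i j = (p : ℤ_[p]) ^ 2 * y := by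
    intro i j
    have h3 : PadicInt.toZModPow (p := p) 2 ((A ^ M - 1) i j) = 0 := by
      have h4 : (PadicInt.toZModPow (p := p) 2).mapMatrix (A ^ M - 1) = 0 := by
        rw [map_sub, h1, map_one, sub_self]
      simpa using congrFun (congrFun h4 i) j
    exact (toZModPow_eq_zero_iff 2 _).mp h3
  choose Y hY using h2
  refine ⟨M, hM, Matrix.of Y, ?_⟩
  rw [← sub_eq_iff_eq_add']
  ext i j
  simp [hY]

end Eigen

/-! ### Words -/

section Words

theorem shift_iterate_apply (w : ℕ → ℕ) (m i : ℕ) : shift^[m] w i = w (m + i) := by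
  induction m generalizing i with
  | zero => simp
  | succ m ih =>
    rw [Function.iterate_succ_apply', shift, ih]
    congr 1
    omega

theorem pre_eq_pre_iff {w w' : ℕ → ℕ} {n : ℕ} : pre w n = pre w' n ↔ ∀ i < n, w i = w' i := by
  simp [pre]

theorem pre_add (w : ℕ → ℕ) (m n : ℕ) : pre w (m + n) = pre w m ++ pre (shift^[m] w) n := by
  simp [pre, List.range_add, Function.comp_def, shift_iterate_apply]

theorem wordMatrix_append (l l' : List ℕ) :
    wordMatrix (l ++ l') = wordMatrix l * wordMatrix l' := by
  simp [wordMatrix]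

theorem isUnit_det_wordMatrix (l : List ℕ) : IsUnit (wordMatrix l).det := by
  induction l with
  | nil => simp [wordMatrix]
  | cons a l ih =>
    have h : wordMatrix (a :: l) = letterMatrix a * wordMatrix l := by simp [wordMatrix]
    rw [h, Matrix.det_mul]
    refine IsUnit.mul ?_ ih
    simp [letterMatrix, Matrix.det_fin_two]

/-- If `a` is the reduction of a return matrix of `w` to every prefix, then so are its powers; if
moreover `a ≠ 1`, the return times may be taken positive. -/
theorem exists_return_pow {p k : ℕ} {w : ℕ → ℕ} {a : Matrix (Fin 2) (Fin 2) (ZMod (p ^ k))}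
    (ha : ∀ n, a ∈ Vmod p k n w) (ha1 : a ≠ 1) {t : ℕ} (ht : 1 ≤ t) (n : ℕ) :
    ∃ m : ℕ, 1 ≤ m ∧ pre (shift^[m] w) n = pre w n ∧
      (wordMatrix (pre w m)).map (Int.castRingHom (ZMod (p ^ k))) = a ^ t := by
  have base : ∀ n, ∃ m : ℕ, 1 ≤ m ∧ pre (shift^[m] w) n = pre w n ∧
      (wordMatrix (pre w m)).map (Int.castRingHom (ZMod (p ^ k))) = a := by
    intro n
    obtain ⟨-, ⟨m, hm, rfl⟩, h⟩ := ha n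
    refine ⟨m, ?_, hm, h⟩
    rcases Nat.eq_zero_or_pos m with rfl | h0
    · exact absurd (by rw [← h]; simp [pre, wordMatrix]) ha1
    · exact h0
  induction t, ht using Nat.le_induction generalizing n with
  | base => simpa using base n
  | succ t _ ih =>
    obtain ⟨m', hm', hpre', hmat'⟩ := ih n
    -- The prefix repeated after `m` must be long enough to contain the earlier return `m'` and the
    -- `n` letters after it.
    obtain ⟨m, hm, hpre, hmat⟩ := base (m' + n)
    rw [pre_eq_pre_iff] at hpre hpre'
    refine ⟨m + m', by omega, ?_, ?_⟩
    · rw [pre_eq_pre_iff]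
      intro i hi
      have h1 := hpre (m' + i) (by omega)
      have h2 := hpre' i hi
      rw [shift_iterate_apply] at h1 h2 ⊢
      rw [add_assoc, h1, h2]
    · have h3 : pre (shift^[m] w) m' = pre w m' :=
        pre_eq_pre_iff.mpr fun i hi => hpre i (by omega)
      rw [pre_add, h3, wordMatrix_append, pow_succ', Matrix.map_mul, hmat, hmat']

end Words

/-! ### Orbits in homogeneous coordinates and bounds on ε -/

section Orbit

variable {p : ℕ} [Fact p.Prime]

/-- The orbit of the extended shift in homogeneous coordinates. -/
theorem T_iterate_mk (w : ℕ → ℕ) (q : Fin 2 → ℚ_[p]) (hq : q ≠ 0) (m : ℕ) :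
    ∃ h : ((wordMatrix (pre w m)).map (Int.castRingHom ℚ_[p])).transpose.mulVec q ≠ 0,
      (T p)^[m] (w, Projectivization.mk ℚ_[p] q hq) = (shift^[m] w, Projectivization.mk ℚ_[p]
        (((wordMatrix (pre w m)).map (Int.castRingHom ℚ_[p])).transpose.mulVec q) h) := by
  induction m with
  | zero =>
    have h1 : ((wordMatrix (pre w 0)).map (Int.castRingHom ℚ_[p])).transpose.mulVec q = q := by
      simp [pre, wordMatrix]
    refine ⟨h1.symm ▸ hq, ?_⟩
    simp only [Function.iterate_zero, id_eq, h1]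
  | succ m ih =>
    obtain ⟨h, hT⟩ := ih
    have hw : wordMatrix (pre w (m + 1)) = wordMatrix (pre w m) * letterMatrix (w m) := by
      rw [pre_add, wordMatrix_append]
      simp [pre, wordMatrix, shift_iterate_apply]
    have hsymm : (letterMatrixQ p (w m)).transpose = letterMatrixQ p (w m) := by
      ext i j
      fin_cases i <;> fin_cases j <;> simp [letterMatrixQ, letterMatrix]
    have h1 : ((wordMatrix (pre w (m + 1))).map (Int.castRingHom ℚ_[p])).transpose.mulVec q =
        Matrix.toLin' (letterMatrixQ p (w m))
          (((wordMatrix (pre w m)).map (Int.castRingHom ℚ_[p])).transpose.mulVec q) := by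
      rw [hw, Matrix.map_mul, Matrix.transpose_mul, Matrix.toLin'_apply, Matrix.mulVec_mulVec]
      congr 2
    have h2 : ((wordMatrix (pre w (m + 1))).map (Int.castRingHom ℚ_[p])).transpose.mulVec q ≠ 0 := by
      rw [h1]
      exact fun h0 => h (letterMatrixQ_injective p (w m) (by rw [h0, map_zero]))
    refine ⟨h2, ?_⟩
    rw [Function.iterate_succ_apply', hT, T]
    ext1
    · simp only [Function.iterate_succ_apply']
    · have h3 : shift^[m] w 0 = w m := by rw [shift_iterate_apply, add_zero]
      simp only [h3, letterAct, Projectivization.map_mk, h1]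

/-- Every point of the projective line over `ℚ_p` has integral coordinates one of which is `1`. -/
theorem exists_integral_coordinates (x : Line p) :
    ∃ X : Fin 2 → ℤ_[p], (∃ j, X j = 1) ∧ ∃ h : (fun i => (X i : ℚ_[p])) ≠ 0,
      x = Projectivization.mk ℚ_[p] (fun i => (X i : ℚ_[p])) h := by
  obtain ⟨j, hj⟩ := Finite.exists_max fun i => ‖x.rep i‖
  have hj0 : x.rep j ≠ 0 := by
    intro h0
    refine x.rep_nonzero (funext fun i => ?_)
    have := hj i
    rw [h0, norm_zero] at this
    exact norm_le_zero_iff.mp this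
  have hle : ∀ i, ‖x.rep i / x.rep j‖ ≤ 1 := fun i => by
    rw [norm_div]
    exact div_le_one_of_le₀ (hj i) (norm_nonneg _)
  refine ⟨fun i => ⟨x.rep i / x.rep j, hle i⟩, ⟨j, PadicInt.ext (div_self hj0)⟩, ?_, ?_⟩
  · intro h0
    exact one_ne_zero ((div_self hj0).symm.trans (congrFun h0 j))
  · conv_lhs => rw [← x.mk_rep]
    rw [Projectivization.mk_eq_mk_iff']
    refine ⟨x.rep j, ?_⟩
    ext i
    simp only [Pi.smul_apply, smul_eq_mul]
    exact mul_div_cancel₀ _ hj0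

theorem le_one_of_badVec {ε : ℝ} {v : Fin 2 → ℚ_[p]} (h : BadVec p ε v) : ε ≤ 1 := by
  have h1 := h 1 0 (by simp)
  simp only [Int.cast_one, Int.cast_zero, abs_one, abs_zero, one_mul, zero_mul, add_zero] at h1
  have h2 : max (1 : ℝ) 0 = 1 := max_eq_left zero_le_one
  rw [h2, one_pow, inv_one, one_mul] at h1
  refine h1.trans ?_
  rw [← div_eq_mul_inv]
  exact div_le_one_of_le₀ (le_max_left _ _) (le_max_of_le_left (norm_nonneg _))

/-- A small integral linear form at a point of the orbit bounds the constant `ε`. -/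
theorem le_of_mem_LMad {ε : ℝ} {w : ℕ → ℕ} {X : Fin 2 → ℤ_[p]} (hX : ∃ j, X j = 1)
    {hX0 : (fun i => (X i : ℚ_[p])) ≠ 0}
    (hmem : (w, Projectivization.mk ℚ_[p] (fun i => (X i : ℚ_[p])) hX0) ∈ LMad p ε)
    {m : ℕ} (hm : 1 ≤ m) {v : Fin 2 → ℕ} (hv : v ≠ 0) {C : ℕ} (hvC : ∀ i, v i ≤ C) {k : ℕ}
    (hk : (p : ℤ_[p]) ^ k ∣ X ⬝ᵥ ((wordMatrix (pre w m)).map (Int.castRingHom ℤ_[p])).mulVec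
      (fun i => (v i : ℤ_[p]))) :
    ε ≤ (C : ℝ) ^ 2 * ((p : ℝ) ^ k)⁻¹ := by
  obtain ⟨hq0, hT⟩ := T_iterate_mk w _ hX0 m
  have hbad := (hmem m hm).2
  rw [hT, mk_mem_PBad] at hbad
  set M := wordMatrix (pre w m) with hM
  set Q : Fin 2 → ℤ_[p] := (M.map (Int.castRingHom ℤ_[p])).transpose.mulVec X with hQ
  have hQq : ∀ i, (M.map (Int.castRingHom ℚ_[p])).transpose.mulVec (fun i => (X i : ℚ_[p])) i =
      (Q i : ℚ_[p]) := by
    intro i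
    fin_cases i <;> simp [hQ, Matrix.mulVec, dotProduct, Fin.sum_univ_two]
  -- Word matrices have unit determinant, so the orbit vector remains primitive and the normalising
  -- factor costs nothing.
  have hone : 1 ≤ max ‖(Q 0 : ℚ_[p])‖ ‖(Q 1 : ℚ_[p])‖ := by
    by_contra! hlt
    obtain ⟨j, hj⟩ := hX
    have hdvd : ∀ i, (p : ℤ_[p]) ∣ Q i := by
      intro i
      rw [← PadicInt.norm_lt_one_iff_dvd]
      fin_cases i
      · exact (le_max_left _ _).trans_lt hlt
      · exact (le_max_right _ _).trans_lt hlt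
    have hadj : (M.map (Int.castRingHom ℤ_[p])).transpose.adjugate.mulVec Q
        = (M.map (Int.castRingHom ℤ_[p])).transpose.det • X := by
      rw [hQ, Matrix.mulVec_mulVec, Matrix.adjugate_mul, Matrix.smul_mulVec, Matrix.one_mulVec]
    have hdet : IsUnit (M.map (Int.castRingHom ℤ_[p])).transpose.det := by
      have h1 : (M.map (Int.castRingHom ℤ_[p])).det = Int.castRingHom ℤ_[p] M.det :=
        ((Int.castRingHom ℤ_[p]).map_det M).symm
      rw [Matrix.det_transpose, h1]
      exact (isUnit_det_wordMatrix _).map _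
    have h2 := congrFun hadj j
    rw [Pi.smul_apply, hj, smul_eq_mul, mul_one] at h2
    rw [← h2] at hdet
    refine PadicInt.prime_p.not_isUnit (isUnit_of_dvd_unit ?_ hdet)
    simp only [Matrix.mulVec, dotProduct]
    exact Finset.dvd_sum fun i _ => (hdvd i).mul_left _
  have hvne : ((v 0 : ℤ), (v 1 : ℤ)) ≠ (0, 0) := by
    intro h0
    simp only [Prod.mk.injEq, Nat.cast_eq_zero] at h0
    exact hv (by ext i; fin_cases i <;> simp [h0])
  have hb := hbad _ _ hvne
  rw [hQq, hQq] at hb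
  have hform : ((v 0 : ℤ) : ℚ_[p]) * (Q 0 : ℚ_[p]) + ((v 1 : ℤ) : ℚ_[p]) * (Q 1 : ℚ_[p]) =
      ((X ⬝ᵥ (M.map (Int.castRingHom ℤ_[p])).mulVec (fun i => (v i : ℤ_[p])) : ℤ_[p]) : ℚ_[p]) := by
    simp [hQ, Matrix.mulVec, dotProduct, Fin.sum_univ_two]
    ring
  have hnorm : ‖((v 0 : ℤ) : ℚ_[p]) * (Q 0 : ℚ_[p]) + ((v 1 : ℤ) : ℚ_[p]) * (Q 1 : ℚ_[p])‖ ≤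
      ((p : ℝ) ^ k)⁻¹ := by
    rw [hform, PadicInt.padic_norm_e_of_padicInt]
    have h3 := (PadicInt.norm_le_pow_iff_mem_span_pow _ k).mpr (Ideal.mem_span_singleton.mpr hk)
    rwa [zpow_neg, zpow_natCast] at h3
  set D := max |((v 0 : ℤ) : ℝ)| |((v 1 : ℤ) : ℝ)| with hD
  have hD1 : 0 < D := by
    by_contra! h4
    have h5 := (le_max_left _ _).trans h4
    have h6 := (le_max_right _ _).trans h4
    rw [abs_nonpos_iff] at h5 h6
    exact hvne (by ext <;> simp only <;> [exact_mod_cast h5; exact_mod_cast h6])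
  have hDC : D ≤ C := by
    refine max_le ?_ ?_ <;> simp [hvC]
  have h7 : (D ^ 2)⁻¹ * ε ≤ ((p : ℝ) ^ k)⁻¹ := by
    refine (hb.trans ?_)
    calc _ ≤ ((p : ℝ) ^ k)⁻¹ * 1 := by
          refine mul_le_mul hnorm (inv_le_one_of_one_le₀ hone) (by positivity) (by positivity)
      _ = _ := mul_one _
  rw [inv_mul_le_iff₀ (by positivity)] at h7
  refine h7.trans ?_
  gcongr

end Orbit

/-! ### Uniform transversality and integral approximation -/

section Transversality

variable {p : ℕ} [Fact p.Prime]

/-- The vector orthogonal to `X`. -/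
def perp {R : Type*} [Neg R] (X : Fin 2 → R) : Fin 2 → R := ![-X 1, X 0]

theorem perp_ne_zero {X : Fin 2 → ℤ_[p]} (hX : ∃ j, X j = 1) : perp X ≠ 0 := by
  obtain ⟨j, hj⟩ := hX
  intro h
  have h0 := congrFun h 0
  have h1 := congrFun h 1
  simp only [perp, Matrix.cons_val_zero, Matrix.cons_val_one, Pi.zero_apply, neg_eq_zero] at h0 h1
  fin_cases j <;> simp_all

theorem dotProduct_perp {R : Type*} [CommRing R] (X : Fin 2 → R) : X ⬝ᵥ perp X = 0 := by
  simp [perp, dotProduct, Fin.sum_univ_two]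
  ring

/-- Up to sign, the cross product of `perp X` with `A^M (perp X)` is `p²` times the form in `h`. -/
theorem mk_perp_mem_eigenpoints {A Y : Matrix (Fin 2) (Fin 2) ℤ_[p]} (hA : A ∈ SLtilde p)
    {M : ℕ} (hM : 0 < M) (hY : A ^ M = 1 + (p : ℤ_[p]) ^ 2 • Y) {X : Fin 2 → ℤ_[p]}
    (hX : perp X ≠ 0) (h : X ⬝ᵥ Y.mulVec (perp X) = 0) :
    Projectivization.mk (PadicAlgCl p) (intToAlgCl p ∘ perp X) (intToAlgCl_comp_ne_zero hX) ∈
      eigenpoints p A := by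
  refine mk_mem_eigenpoints_of_cross_pow hA hM hX ?_
  rw [hY]
  simp only [perp, Matrix.mulVec, dotProduct, Fin.sum_univ_two, Matrix.add_apply,
    Matrix.smul_apply, smul_eq_mul, Matrix.one_apply, Matrix.cons_val_zero,
    Matrix.cons_val_one] at h ⊢
  simp only [if_true, Fin.isValue, zero_ne_one, one_ne_zero, if_false]
  linear_combination (-(p : ℤ_[p]) ^ 2) * h

theorem dvd_of_norm_le {a b : ℤ_[p]} (h : ‖b‖ ≤ ‖a‖) : a ∣ b := by
  by_cases ha : a = 0
  · rw [ha, norm_zero] at h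
    rw [norm_le_zero_iff.mp h]
    exact dvd_zero a
  · have h1 : ‖(b : ℚ_[p]) / a‖ ≤ 1 := by
      rw [norm_div]
      exact div_le_one_of_le₀ h (norm_nonneg _)
    have ha' : (a : ℚ_[p]) ≠ 0 := by simpa using ha
    exact ⟨⟨(b : ℚ_[p]) / a, h1⟩, PadicInt.ext (mul_div_cancel₀ (b : ℚ_[p]) ha').symm⟩

/-- Two binary forms without common zero on the projective line do not both become small. -/
theorem exists_uniform_dvd (Y₁ Y₂ : Matrix (Fin 2) (Fin 2) ℤ_[p])
    (h : ∀ X : Fin 2 → ℤ_[p], (∃ j, X j = 1) →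
      ¬ (X ⬝ᵥ Y₁.mulVec (perp X) = 0 ∧ X ⬝ᵥ Y₂.mulVec (perp X) = 0)) :
    ∃ L : ℕ, ∀ X : Fin 2 → ℤ_[p], (∃ j, X j = 1) →
      X ⬝ᵥ Y₁.mulVec (perp X) ∣ (p : ℤ_[p]) ^ L ∨ X ⬝ᵥ Y₂.mulVec (perp X) ∣ (p : ℤ_[p]) ^ L := by
  let f : (Fin 2 → ℤ_[p]) → ℝ := fun X =>
    max ‖X ⬝ᵥ Y₁.mulVec (perp X)‖ ‖X ⬝ᵥ Y₂.mulVec (perp X)‖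
  have hf : Continuous f := by
    simp only [f, perp, Matrix.mulVec, dotProduct, Fin.sum_univ_two, Matrix.cons_val_zero,
      Matrix.cons_val_one]
    fun_prop
  have hclosed : IsClosed {X : Fin 2 → ℤ_[p] | ∃ j, X j = 1} := by
    rw [Set.ofPred_exists]
    exact isClosed_iUnion_of_finite fun j => isClosed_eq (continuous_apply j) continuous_const
  -- A closed subset of the compact space `ℤ_p²`, so the larger of the two norms attains a positive
  -- minimum.
  obtain ⟨X₀, hX₀, hmin⟩ := hclosed.isCompact.exists_isMinOn ⟨fun _ => 1, 0, rfl⟩ hf.continuousOn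
  have hpos : 0 < f X₀ := by
    by_contra! h0
    exact h X₀ hX₀ ⟨norm_le_zero_iff.mp ((le_max_left _ _).trans h0),
      norm_le_zero_iff.mp ((le_max_right _ _).trans h0)⟩
  obtain ⟨L, hL⟩ := PadicInt.exists_pow_neg_lt p hpos
  refine ⟨L, fun X hX => ?_⟩
  have h1 : ‖(p : ℤ_[p]) ^ L‖ ≤ f X := by
    rw [PadicInt.norm_p_pow]
    exact hL.le.trans (hmin hX)
  exact (le_max_iff.mp h1).imp dvd_of_norm_le dvd_of_norm_le

theorem exists_nat_approx (x : Fin 2 → ℤ_[p]) (S : ℕ) :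
    ∃ v : Fin 2 → ℕ, (∀ i, v i ≤ p ^ S) ∧
      ∃ z : Fin 2 → ℤ_[p], (fun i => (v i : ℤ_[p])) = x + (p : ℤ_[p]) ^ S • z := by
  have h := fun i => Ideal.mem_span_singleton.mp (PadicInt.appr_spec S (x i))
  choose z hz using h
  refine ⟨fun i => (x i).appr S, fun i => ((x i).appr_lt S).le, -z, ?_⟩
  ext i : 1
  simp only [Pi.add_apply, Pi.smul_apply, Pi.neg_apply, smul_eq_mul]
  linear_combination -hz i

/-- A bounded integral vector near `perp X` on which the orbit of `A` meets the orthogonal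
complement of `X` modulo every power of `p`. -/
theorem exists_nat_vector {A Y : Matrix (Fin 2) (Fin 2) ℤ_[p]} {M : ℕ} (hM : 0 < M)
    (hY : A ^ M = 1 + (p : ℤ_[p]) ^ 2 • Y) {X : Fin 2 → ℤ_[p]} (hX : ∃ j, X j = 1) {L : ℕ}
    (hL : X ⬝ᵥ Y.mulVec (perp X) ∣ (p : ℤ_[p]) ^ L) :
    ∃ v : Fin 2 → ℕ, v ≠ 0 ∧ (∀ i, v i ≤ p ^ (L + 2)) ∧ ∀ k : ℕ, ∃ t : ℕ, 1 ≤ t ∧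
      (p : ℤ_[p]) ^ k ∣ X ⬝ᵥ (A ^ t).mulVec (fun i => (v i : ℤ_[p])) := by
  -- Precision `L` would make `X · v` divisible by `X · Y (perp X)`; the extra `p²` provides the
  -- factor required below and keeps `X · Yv` a unit multiple of `X · Y (perp X)`.
  obtain ⟨v, hv, z, hz⟩ := exists_nat_approx (perp X) (L + 2)
  obtain ⟨u, hu⟩ := hL
  refine ⟨v, ?_, hv, fun k => ?_⟩
  · rintro rfl
    obtain ⟨j, hj⟩ := hX
    have h0 := congrFun hz 0
    have h1 := congrFun hz 1
    simp only [perp, Pi.zero_apply, Nat.cast_zero, Pi.add_apply, Pi.smul_apply, smul_eq_mul,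
      Matrix.cons_val_zero, Matrix.cons_val_one] at h0 h1
    have hp : (p : ℤ_[p]) ∣ X j := by
      fin_cases j <;> simp only [Fin.zero_eta, Fin.mk_one]
      · exact ⟨-((p : ℤ_[p]) ^ (L + 1) * z 1), by linear_combination -h1⟩
      · exact ⟨(p : ℤ_[p]) ^ (L + 1) * z 0, by linear_combination h0⟩
    rw [hj] at hp
    exact PadicInt.prime_p.not_isUnit (isUnit_of_dvd_one hp)
  · have hXv : X ⬝ᵥ (fun i => (v i : ℤ_[p])) = (p : ℤ_[p]) ^ (L + 2) * (X ⬝ᵥ z) := by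
      rw [hz, dotProduct_add, dotProduct_perp, dotProduct_smul, zero_add, smul_eq_mul]
    have hXYv : X ⬝ᵥ Y.mulVec (fun i => (v i : ℤ_[p])) =
        X ⬝ᵥ Y.mulVec (perp X) * (1 + p * (p * u * (X ⬝ᵥ Y.mulVec z))) := by
      rw [hz, Matrix.mulVec_add, Matrix.mulVec_smul, dotProduct_add, dotProduct_smul, smul_eq_mul]
      linear_combination (p : ℤ_[p]) ^ 2 * (X ⬝ᵥ Y.mulVec z) * hu
    have hU : IsUnit (1 + p * (p * u * (X ⬝ᵥ Y.mulVec z))) :=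
      isUnit_of_dvd_sub (b := 1) (by simp) isUnit_one
    have hdvd : (p : ℤ_[p]) ^ 2 * (X ⬝ᵥ Y.mulVec (fun i => (v i : ℤ_[p]))) ∣
        X ⬝ᵥ (fun i => (v i : ℤ_[p])) := by
      rw [hXv, hXYv, pow_add, mul_comm ((p : ℤ_[p]) ^ L), mul_assoc ((p : ℤ_[p]) ^ 2)]
      refine mul_dvd_mul_left _ (Dvd.dvd.mul_right ?_ _)
      rw [hU.mul_right_dvd]
      exact ⟨u, hu⟩
    obtain ⟨n, hn, hk⟩ := exists_pow_dvd_dotProduct Y X _ hdvd k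
    refine ⟨M * n, Nat.mul_pos hM hn, ?_⟩
    rwa [pow_mul, hY]

/-- The identity has eigenvalue 1, a root of unity. This is needed to exclude the return time 0,
which `LMad` does not test. -/
theorem ne_one_of_mem_SLtilde {A : Matrix (Fin 2) (Fin 2) ℤ_[p]} (hA : A ∈ SLtilde p) : A ≠ 1 := by
  rintro rfl
  obtain ⟨v, ⟨μ, hμ⟩, -⟩ := hA.2.1.exists_ne (Classical.choice hA.2.1.nonempty.to_subtype).1
  have h1 := hμ.apply_eq_smul
  have h2 : toAlgCl p 1 = 1 := by
    rw [toAlgCl_eq_map]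
    simp
  have h3 : μ = 1 := by
    rw [h2, Matrix.toLin'_one, LinearMap.id_apply] at h1
    have h4 : (μ - 1) • v.rep = 0 := by rw [sub_smul, one_smul, ← h1, sub_self]
    exact sub_eq_zero.mp ((smul_eq_zero.mp h4).resolve_right v.rep_nonzero)
  exact eigenvalue_pow_ne_one hA (Module.End.hasEigenvalue_of_hasEigenvector hμ) one_pos
    (by rw [h3, one_pow])

theorem exists_forall_red_ne_one {A : Matrix (Fin 2) (Fin 2) ℤ_[p]} (hA : A ≠ 1) :
    ∃ k₀ : ℕ, ∀ k, k₀ ≤ k → red p k A ≠ 1 := by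
  by_contra! hcon
  refine hA ?_
  ext i j : 1
  rw [← PadicInt.ext_of_toZModPow]
  intro n
  obtain ⟨k, hk, hred⟩ := hcon n
  have h1 := congrFun (congrFun hred i) j
  have h2 : PadicInt.toZModPow k (A i j) =
      PadicInt.toZModPow k ((1 : Matrix (Fin 2) (Fin 2) ℤ_[p]) i j) := by
    rw [red, Matrix.map_apply] at h1
    rw [h1, Matrix.one_apply, Matrix.one_apply]
    split_ifs <;> simp
  rw [← PadicInt.zmod_cast_comp_toZModPow n k hk, RingHom.comp_apply, RingHom.comp_apply, h2]

theorem red_pow (k t : ℕ) (A : Matrix (Fin 2) (Fin 2) ℤ_[p]) : red p k (A ^ t) = red p k A ^ t :=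
  map_pow (PadicInt.toZModPow (p := p) k).mapMatrix A t

theorem dvd_dotProduct_of_red_eq {k : ℕ} {B : Matrix (Fin 2) (Fin 2) ℤ_[p]}
    {M : Matrix (Fin 2) (Fin 2) ℤ} (h : M.map (Int.castRingHom (ZMod (p ^ k))) = red p k B)
    (X v : Fin 2 → ℤ_[p]) (hB : (p : ℤ_[p]) ^ k ∣ X ⬝ᵥ B.mulVec v) :
    (p : ℤ_[p]) ^ k ∣ X ⬝ᵥ (M.map (Int.castRingHom ℤ_[p])).mulVec v := by
  have hentry : ∀ i j, PadicInt.toZModPow k ((M i j : ℤ) : ℤ_[p]) =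
      PadicInt.toZModPow k (B i j) := by
    intro i j
    have h1 := congrFun (congrFun h i) j
    simp only [red, Matrix.map_apply, Int.coe_castRingHom] at h1
    rw [map_intCast, h1]
  rw [← toZModPow_eq_zero_iff] at hB ⊢
  rw [← hB]
  simp only [Matrix.mulVec, dotProduct, Matrix.map_apply, Int.coe_castRingHom, map_sum, map_mul,
    hentry]

theorem le_of_forall_red_mem_Vmod {A : Matrix (Fin 2) (Fin 2) ℤ_[p]} {w : ℕ → ℕ} {k : ℕ}
    (hV : ∀ n, red p k A ∈ Vmod p k n w) (hne : red p k A ≠ 1) {X : Fin 2 → ℤ_[p]}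
    (hX : ∃ j, X j = 1) {hX0 : (fun i => (X i : ℚ_[p])) ≠ 0} {ε : ℝ}
    (hmem : (w, Projectivization.mk ℚ_[p] (fun i => (X i : ℚ_[p])) hX0) ∈ LMad p ε)
    {v : Fin 2 → ℕ} (hv : v ≠ 0) {C : ℕ} (hvC : ∀ i, v i ≤ C) {t : ℕ} (ht : 1 ≤ t)
    (hdvd : (p : ℤ_[p]) ^ k ∣ X ⬝ᵥ (A ^ t).mulVec (fun i => (v i : ℤ_[p]))) :
    ε ≤ (C : ℝ) ^ 2 * ((p : ℝ) ^ k)⁻¹ := by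
  -- Only the matrix and `m ≥ 1` matter now, so prefix length 0 suffices.
  obtain ⟨m, hm, -, hmat⟩ := exists_return_pow hV hne ht 0
  rw [← red_pow] at hmat
  exact le_of_mem_LMad hX hmem hm hv hvC (dvd_dotProduct_of_red_eq hmat X _ hdvd)

end Transversality

end PLC

theorem theorem6p1 (p : ℕ) [Fact p.Prime]
    (A₁ A₂ : Matrix (Fin 2) (Fin 2) ℤ_[p])
    (hA₁ : A₁ ∈ PLC.SLtilde p) (hA₂ : A₂ ∈ PLC.SLtilde p)
    (w₁ w₂ w₃ w₄ : ℙ (PadicAlgCl p) (Fin 2 → PadicAlgCl p))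
    (hw₁₂ : PLC.eigenpoints p A₁ = {w₁, w₂}) (hw₃₄ : PLC.eigenpoints p A₂ = {w₃, w₄})
    (hdist : [w₁, w₂, w₃, w₄].Nodup) :
    ∃ c : ℝ, 0 < c ∧
      ∀ (N : ℕ) (w : ℕ → ℕ), w ∈ PLC.words N →
      ∀ k : ℕ,
        (∀ n : ℕ, PLC.red p k A₁ ∈ PLC.Vmod p k n w ∧ PLC.red p k A₂ ∈ PLC.Vmod p k n w) →
      ∀ (x : PLC.Line p) (ε : ℝ), c * ((p : ℝ) ^ k)⁻¹ ≤ ε → (w, x) ∉ PLC.LMad p ε := by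
  obtain ⟨M₁, hM₁, Y₁, hY₁⟩ := PLC.exists_pow_eq_one_add_smul hA₁.1
  obtain ⟨M₂, hM₂, Y₂, hY₂⟩ := PLC.exists_pow_eq_one_add_smul hA₂.1
  have hdisj : ∀ q, q ∈ PLC.eigenpoints p A₁ → q ∉ PLC.eigenpoints p A₂ := by
    intro q hq hq'
    rw [hw₁₂] at hq
    rw [hw₃₄] at hq'
    simp only [List.nodup_cons, List.mem_cons, List.not_mem_nil, not_or] at hdist
    rcases hq with rfl | rfl <;> rcases hq' with h | h <;> tauto
  obtain ⟨L, hL⟩ := PLC.exists_uniform_dvd Y₁ Y₂ fun X hX ⟨h₁, h₂⟩ =>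
    hdisj _ (PLC.mk_perp_mem_eigenpoints hA₁ hM₁ hY₁ (PLC.perp_ne_zero hX) h₁)
      (PLC.mk_perp_mem_eigenpoints hA₂ hM₂ hY₂ (PLC.perp_ne_zero hX) h₂)
  obtain ⟨k₁, hk₁⟩ := PLC.exists_forall_red_ne_one (PLC.ne_one_of_mem_SLtilde hA₁)
  obtain ⟨k₂, hk₂⟩ := PLC.exists_forall_red_ne_one (PLC.ne_one_of_mem_SLtilde hA₂)
  have hp : 1 < (p : ℝ) := by exact_mod_cast (Nat.Prime.one_lt Fact.out)
  have hp0 : 0 < (p : ℝ) := zero_lt_one.trans hp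
  -- The first summand is the squared bound on `v`. The second makes `c p^{-k} > 1 ≥ ε` for the
  -- finitely many `k` where a reduction may be the identity, and makes the inequality strict for
  -- the others.
  refine ⟨((p ^ (L + 2) : ℕ) : ℝ) ^ 2 + (p : ℝ) ^ max k₁ k₂, by positivity, ?_⟩
  intro N w _ k hV x ε hε hmem
  have hpk : 0 < ((p : ℝ) ^ k)⁻¹ := by positivity
  rcases lt_or_ge k (max k₁ k₂) with hk | hk
  · have h1 : 1 < ((p : ℝ) ^ max k₁ k₂) * ((p : ℝ) ^ k)⁻¹ := by
      rw [← div_eq_mul_inv, one_lt_div (by positivity)]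
      exact pow_lt_pow_right₀ hp hk
    have h2 : ε ≤ 1 := PLC.le_one_of_badVec (hmem 1 le_rfl).2
    have h3 : 0 ≤ ((p ^ (L + 2) : ℕ) : ℝ) ^ 2 * ((p : ℝ) ^ k)⁻¹ := by positivity
    rw [add_mul] at hε
    linarith
  · obtain ⟨X, hX, hX0, rfl⟩ := PLC.exists_integral_coordinates x
    have hbound : ε ≤ ((p ^ (L + 2) : ℕ) : ℝ) ^ 2 * ((p : ℝ) ^ k)⁻¹ := by
      rcases hL X hX with h | h
      · obtain ⟨v, hv, hvC, ht⟩ := PLC.exists_nat_vector hM₁ hY₁ hX h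
        obtain ⟨t, ht1, hdvd⟩ := ht k
        exact PLC.le_of_forall_red_mem_Vmod (fun n => (hV n).1)
          (hk₁ k ((le_max_left _ _).trans hk)) hX hmem hv hvC ht1 hdvd
      · obtain ⟨v, hv, hvC, ht⟩ := PLC.exists_nat_vector hM₂ hY₂ hX h
        obtain ⟨t, ht1, hdvd⟩ := ht k
        exact PLC.le_of_forall_red_mem_Vmod (fun n => (hV n).2)
          (hk₂ k ((le_max_right _ _).trans hk)) hX hmem hv hvC ht1 hdvd
    have h4 : 0 < ((p : ℝ) ^ max k₁ k₂) * ((p : ℝ) ^ k)⁻¹ := by positivity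
    rw [add_mul] at hε
    linarith
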